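/- Let $k$ be a field of arbitrary characteristic, let $X$ be a smooth variety over $k$ (an integral, separated $k$-scheme, smooth and of finite type), and let $\Delta=\sum_{i} D_i$ be a finite simple normal crossing divisor on $X$: the $D_i$ are integral closed subschemes, and for every point $x\in X$ there is a regular system of parameters $z_1,\dots,z_n$ of $\mathcal O_{X,x}$ such that every $D_i$ passing through $x$ is defined at $x$ by one of the $z_j$, with different $z_j$ for different $D_i$. A stratum of $(X,\Delta)$ is an irreducible component of an intersection $D_{i_1}\cap\dots\cap D_{i_r}$, $r\ge 0$ (for $r=0$ the intersection is $X$ itself). A quasi-coherent ideal sheaf $I\subset\mathcal O_X$ is called toroidal if $X$ is covered by open sets $U$ such that $I|_U=\sum_s\mathcal O_U\bigl(-\sum_i m_{is}D_i|_U\bigr)$ for a family, depending on $U$ and possibly empty, of vectors $(m_{is})_i$ of natural numbers (the empty sum being the zero ideal sheaf). For an irreducible closed subset $W\subset X$ with generic point $\eta$, let $\operatorname{mult}_W I\in\mathbb N\cup\{\infty\}$ be the supremum of all $n$ with $I_\eta\subset\mathfrak m_\eta^n$, where $\mathfrak m_\eta$ is the maximal ideal of $\mathcal O_{X,\eta}$.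 Let $J\subset\mathcal O_X$ be a quasi-coherent ideal sheaf. Then there is a unique smallest toroidal ideal sheaf $J^t$ containing $J$ (that is, $J^t$ is toroidal, $J\subset J^t$, and $J^t\subset I$ for every toroidal ideal sheaf $I\supset J$); it is called the toroidal hull of $J$. Furthermore, $\operatorname{mult}_W J^t=\operatorname{mult}_W J$ for every stratum $W$ of $(X,\Delta)$. -/

import Mathlib

open CategoryTheory AlgebraicGeometry

universe u v

noncomputable section

namespace ToroidalHull

variable {X : Scheme.{u}} {ι : Type v}

/-- The stalk at `x` of a (quasi-coherent) ideal sheaf `I`, as an ideal of the local ring at `x`: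
the ideal generated by the germs of the sections of `I` over the affine neighbourhoods of `x`. -/
def stalkIdeal (I : X.IdealSheafData) (x : X) : Ideal (X.presheaf.stalk x) :=
  ⨆ (U : X.affineOpens) (hx : x ∈ U.1), (I.ideal U).map (X.presheaf.germ U.1 x hx).hom

/-- The multiplicity of `I` at `x`: the largest `n ≤ ∞` such that
`I_x` is contained in the `n`-th power of the maximal ideal of the local ring at `x`. -/
def multAt (I : X.IdealSheafData) (x : X) : ℕ∞ :=
  ⨆ (n : ℕ) (_ : stalkIdeal I x ≤ IsLocalRing.maximalIdeal (X.presheaf.stalk x) ^ n), (n : ℕ∞)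

/-- The multiplicity of `I` along an irreducible closed subset `W`, that is, at its
generic point. -/
def multAlong (I : X.IdealSheafData) {W : Set X} (hW : IsIrreducible W) : ℕ∞ :=
  multAt I hW.genericPoint

/-- A family of closed subschemes `D i` (given by their ideal sheaves) is the family of components
of a simple normal crossing divisor: every `D i` is integral, and at every point `x` of `X` there is
a regular system of parameters `z 1, …, z n` of the local ring such that each `D i` through `x` is
defined near `x` by one of the `z j`, with different `z j` for different `D i`. -/
structure IsSNC (D : ι → X.IdealSheafData) : Prop where
  isIntegral : ∀ i, IsIntegral (D i).subscheme
  exists_coordinates : ∀ x : X, ∃ (n : ℕ) (z : Fin n → X.presheaf.stalk x)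
    (c : {i : ι // x ∈ (D i).support} → Fin n),
    ringKrullDim (X.presheaf.stalk x) = n ∧
    Ideal.span (Set.range z) = IsLocalRing.maximalIdeal (X.presheaf.stalk x) ∧
    Function.Injective c ∧
    ∀ i, stalkIdeal (D i.1) x = Ideal.span {z (c i)}

/-- Strata: the irreducible components of the intersections `D i₁ ∩ ⋯ ∩ D iᵣ`, `r ≥ 0`
(for `r = 0` the intersection is `X`). -/
def IsStratum (D : ι → X.IdealSheafData) (W : Set X) : Prop :=
  ∃ T : Finset ι, Maximal
    (fun S : Set X ↦ IsIrreducible S ∧ S ⊆ ⋂ i ∈ T, ((D i).support : Set X)) W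

lemma IsStratum.isIrreducible {D : ι → X.IdealSheafData} {W : Set X} (h : IsStratum D W) :
    IsIrreducible W :=
  h.choose_spec.prop.1

/-- The ideal sheaf `𝒪_X(-∑ mᵢ Dᵢ)`. -/
def monomialIdeal [Fintype ι] (D : ι → X.IdealSheafData) (m : ι → ℕ) : X.IdealSheafData :=
  ∏ i, D i ^ m i

/-- Two ideal sheaves have the same restriction to the open set `U`. -/
def EqOn (I J : X.IdealSheafData) (U : X.Opens) : Prop :=
  ∀ V : X.affineOpens, V.1 ≤ U → I.ideal V = J.ideal V

/-- `I` is toroidal if `X` is covered by open sets `U` such that `I|_U` is a sum of ideal sheaves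
`𝒪_U(-∑ mᵢ Dᵢ|_U)` (the empty sum is the zero ideal sheaf). -/
def IsToroidal [Fintype ι] (D : ι → X.IdealSheafData) (I : X.IdealSheafData) : Prop :=
  ∀ x : X, ∃ U : X.Opens, x ∈ U ∧ ∃ S : Set (ι → ℕ), EqOn I (⨆ m ∈ S, monomialIdeal D m) U

/-- `Jt` is a smallest toroidal ideal sheaf containing `J`. -/
def IsToroidalHull [Fintype ι] (D : ι → X.IdealSheafData) (J Jt : X.IdealSheafData) : Prop :=
  IsLeast {I : X.IdealSheafData | IsToroidal D I ∧ J ≤ I} Jt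

end ToroidalHull

end

/-! At a point `x` the components through it have equations `z_i` forming part of a regular system
of parameters. Let `P = (z_i)` and `Q_m = (z_i^(m_i+1))`. A monomial lies in `Q_m` as soon as some
exponent exceeds `m_i`, so a monomial ideal containing `J` but not inside `Q_m` must contain a
divisor of `z^m`, hence `z^m`. The local hull is therefore generated by the `z^m` with `J ⊄ Q_m`
(`monomialHull_le`).

This ideal contains `J` (`le_monomialHull`): expand `f ∈ J` in monomials degree by degree. If `z^k`
is not one of the generators, `J` and the hull both lie in `Q_k`, and `(Q_k : z^k) = P` pushes that
term into the next power of `P`. Krull's intersection theorem finishes.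

The local hulls glue because the exponents found at `x` serve a whole neighbourhood
(`exists_stalkIdeal_eq_monomialHull`); this uses that `Q_m` is `P`-primary, also for subsets of the
`z_i`.

At the generic point of a stratum `P` is the maximal ideal. If `J ⊂ P^n` and `z^m` has degree below
`n`, then `J ⊂ P^n ⊂ Q_m`, so only monomials of degree at least `n` enter the hull and the
multiplicity does not drop. -/

namespace ToroidalHull

/-! ### Regular systems of parameters and the primes they generate -/

section RegularLocalRing

open IsLocalRing

variable {R : Type u} [CommRing R]

lemma spanFinrank_span_range_le {S : Type u} [CommRing S] {σ : Type*} [Fintype σ] (z : σ → S) :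
    (Ideal.span (Set.range z)).spanFinrank ≤ Fintype.card σ := by
  classical
  refine (Submodule.spanFinrank_span_le_ncard_of_finite (Set.finite_range z)).trans ?_
  rw [← Set.image_univ]
  exact (Set.ncard_image_le Set.finite_univ).trans (by simp [Set.ncard_univ])

/-- A regular local ring is a domain. -/
theorem isDomain_of_span_range_eq_maximalIdeal (n : ℕ) : ∀ (R : Type u) [CommRing R]
    [IsLocalRing R] [IsNoetherianRing R] (z : Fin n → R),
    Ideal.span (Set.range z) = maximalIdeal R → ringKrullDim R = n → IsDomain R := by
  induction n with
  | zero =>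
    intro R _ _ _ z hz _
    have h0 : maximalIdeal R = ⊥ := by rw [← hz]; simp
    exact ((isField_iff_maximalIdeal_eq).mpr h0).isDomain
  | succ n ih =>
    intro R _ _ _ z hz hdim
    have hht : (maximalIdeal R).height ≠ 0 := by
      intro h
      have := maximalIdeal_height_eq_ringKrullDim (R := R)
      rw [h, hdim] at this
      have h2 : ((0 : ℕ) : WithBot ℕ∞) = ((n + 1 : ℕ) : WithBot ℕ∞) := by simpa using this
      exact absurd (by exact_mod_cast h2) (Nat.succ_ne_zero n).symm
    -- Prime avoidance, which tolerates the non-prime ideal `𝔪 ^ 2`. Avoiding `𝔪 ^ 2` makes `x` a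
    -- parameter; avoiding the minimal primes drives the final Nakayama argument.
    obtain ⟨x, hxm, hx⟩ : ∃ x ∈ maximalIdeal R,
        x ∉ ⋃ p ∈ insert (maximalIdeal R ^ 2) (minimalPrimes R), ((id p : Ideal R) : Set R) := by
      by_contra! hcon
      obtain ⟨p, hp, hmp⟩ := (Ideal.subset_union_prime_finite
        ((minimalPrimes.finite_of_isNoetherianRing R).insert (maximalIdeal R ^ 2)) (f := id)
        (maximalIdeal R ^ 2) (maximalIdeal R ^ 2)
        (fun p hp hp' _ ↦ ((Set.mem_insert_iff.mp hp).resolve_left hp').1.1)).mp hcon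
      rcases Set.mem_insert_iff.mp hp with rfl | hp
      · have h0 : maximalIdeal R = ⊥ := by
          refine Submodule.eq_bot_of_le_smul_of_le_jacobson_bot (maximalIdeal R) _
            (IsNoetherian.noetherian _) ?_ (maximalIdeal_le_jacobson _)
          simpa [pow_two] using hmp
        have := ((isField_iff_maximalIdeal_eq).mpr h0)
        have h1 := ringKrullDim_eq_zero_of_isField this
        rw [hdim] at h1
        exact absurd (by exact_mod_cast h1) (Nat.succ_ne_zero n)
      · have hpp : p.IsPrime := hp.1.1
        have : p = maximalIdeal R := le_antisymm (le_maximalIdeal hpp.ne_top) hmp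
        subst this
        exact hht (Ideal.height_eq_zero_iff.mpr hp)
    simp only [Set.mem_insert_iff, Set.iUnion_iUnion_eq_or_left, Set.mem_union, not_or,
      Set.mem_iUnion, id, SetLike.mem_coe, not_exists] at hx
    obtain ⟨hx2, hxp⟩ := hx
    rw [← hz] at hxm
    obtain ⟨c, hc⟩ := (Ideal.mem_span_range_iff_exists_fun).mp hxm
    have hzm : ∀ i, z i ∈ maximalIdeal R := fun i ↦ hz ▸ Ideal.subset_span ⟨i, rfl⟩
    obtain ⟨i, hi⟩ : ∃ i, IsUnit (c i) := by
      by_contra! hcon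
      apply hx2
      rw [← hc, pow_two]
      exact Ideal.sum_mem _ fun i _ ↦ Ideal.mul_mem_mul (by simpa using hcon i) (hzm i)
    have hxm' : x ∈ maximalIdeal R := hz ▸ hxm
    let I := Ideal.span {x}
    have hI : I ≤ maximalIdeal R := by simpa [I, Ideal.span_le] using hxm'
    have : Nontrivial (R ⧸ I) := Ideal.Quotient.nontrivial_iff.mpr
      (fun h ↦ (maximalIdeal.isMaximal R).ne_top (top_le_iff.mp (h ▸ hI)))
    have : IsLocalRing (R ⧸ I) := .of_surjective' (Ideal.Quotient.mk I) Ideal.Quotient.mk_surjective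
    let z' : Fin n → R ⧸ I := fun j ↦ Ideal.Quotient.mk I (z (i.succAbove j))
    have hz' : Ideal.span (Set.range z') = maximalIdeal (R ⧸ I) := by
      have hmap : (maximalIdeal R).map (Ideal.Quotient.mk I) = maximalIdeal (R ⧸ I) :=
        map_maximalIdeal_of_surjective _ Ideal.Quotient.mk_surjective
      rw [← hmap, ← hz, Ideal.map_span]
      apply le_antisymm
      · apply Ideal.span_mono
        rintro _ ⟨j, rfl⟩
        exact ⟨_, ⟨_, rfl⟩, rfl⟩
      · rw [Ideal.span_le]
        rintro _ ⟨_, ⟨j, rfl⟩, rfl⟩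
        have hne : ∀ j, Ideal.Quotient.mk I (z (i.succAbove j)) ∈ Ideal.span (Set.range z') :=
          fun j ↦ Ideal.subset_span ⟨j, rfl⟩
        -- Modulo `x`, the unit coefficient `c i` expresses `z i` through the other parameters.
        rcases Fin.eq_self_or_eq_succAbove i j with rfl | ⟨j, rfl⟩
        · rw [Fin.sum_univ_succAbove _ j] at hc
          have h0 : Ideal.Quotient.mk I x = 0 :=
            Ideal.Quotient.eq_zero_iff_mem.mpr (Ideal.mem_span_singleton_self x)
          rw [← hc, map_add, map_mul, add_eq_zero_iff_eq_neg] at h0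
          refine (Ideal.unit_mul_mem_iff_mem _ (hi.map (Ideal.Quotient.mk I))).mp ?_
          rw [h0, map_sum]
          refine neg_mem (Ideal.sum_mem _ fun k _ ↦ ?_)
          rw [map_mul]
          exact Ideal.mul_mem_left _ _ (hne k)
        · exact hne j
    have hdim' : ringKrullDim (R ⧸ I) = n := by
      apply le_antisymm
      · refine (ringKrullDim_le_spanFinrank_maximalIdeal (R ⧸ I)).trans ?_
        rw [← hz']
        exact_mod_cast (spanFinrank_span_range_le z').trans (by simp)
      · have h1 := Ideal.height_le_ringKrullDim_quotient_add_one (p := maximalIdeal R) hxm'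
        rw [maximalIdeal_height_eq_ringKrullDim, hdim] at h1
        have h2 : ((n : ℕ∞) : WithBot ℕ∞) + 1 ≤ ringKrullDim (R ⧸ I) + 1 := by
          simpa using h1
        exact (ENat.WithBot.add_le_add_one_right_iff).mp h2
    have hdom := ih (R ⧸ I) z' hz' hdim'
    have hIp : I.IsPrime := (Ideal.Quotient.isDomain_iff_prime I).mp hdom
    obtain ⟨p, hp, hpI⟩ := Ideal.exists_minimalPrimes_le (I := (⊥ : Ideal R)) (J := I) bot_le
    have hpp : p.IsPrime := hp.1.1
    -- Since `p ⊂ (x)` and `x ∉ p`, every element of `p` is `x` times an element of `p`; so `p = 𝔪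
    -- p`.
    have hp0 : p = ⊥ := by
      refine Submodule.eq_bot_of_le_smul_of_le_jacobson_bot (maximalIdeal R) _
        (IsNoetherian.noetherian _) ?_ (maximalIdeal_le_jacobson _)
      intro y hy
      obtain ⟨w, rfl⟩ := Ideal.mem_span_singleton.mp (hpI hy)
      exact Submodule.smul_mem_smul hxm' ((hpp.mem_or_mem hy).resolve_left (hxp p hp))
    subst hp0
    exact IsDomain.of_bot_isPrime R

/-- A subset of a regular system of parameters generates a prime ideal, which does not contain
the other parameters. -/
theorem isPrime_span_image_of_regularParameters [IsLocalRing R] [IsNoetherianRing R] {σ : Type*}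
    [Fintype σ] (z : σ → R) (hz : Ideal.span (Set.range z) = maximalIdeal R)
    (hdim : ringKrullDim R = Fintype.card σ) (T : Set σ) :
    (Ideal.span (z '' T)).IsPrime ∧ ∀ i ∉ T, z i ∉ Ideal.span (z '' T) := by
  classical
  have hzm : ∀ i, z i ∈ maximalIdeal R := fun i ↦ hz ▸ Ideal.subset_span ⟨i, rfl⟩
  constructor
  -- The quotient is again regular: the remaining parameters generate its maximal ideal, and the
  -- dimension drops by at most the size of `T`.
  · let I := Ideal.span (z '' T)
    have hI : I ≤ maximalIdeal R := by
      rw [Ideal.span_le]; rintro _ ⟨i, _, rfl⟩; exact hzm i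
    have : Nontrivial (R ⧸ I) := Ideal.Quotient.nontrivial_iff.mpr
      (fun h ↦ (maximalIdeal.isMaximal R).ne_top (top_le_iff.mp (h ▸ hI)))
    have : IsLocalRing (R ⧸ I) := .of_surjective' (Ideal.Quotient.mk I) Ideal.Quotient.mk_surjective
    let e := Fintype.equivFin {i // i ∉ T}
    let z' : Fin (Fintype.card {i // i ∉ T}) → R ⧸ I :=
      fun j ↦ Ideal.Quotient.mk I (z (e.symm j).1)
    have hz' : Ideal.span (Set.range z') = maximalIdeal (R ⧸ I) := by
      have hmap : (maximalIdeal R).map (Ideal.Quotient.mk I) = maximalIdeal (R ⧸ I) :=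
        map_maximalIdeal_of_surjective _ Ideal.Quotient.mk_surjective
      rw [← hmap, ← hz, Ideal.map_span]
      apply le_antisymm
      · apply Ideal.span_mono
        rintro _ ⟨j, rfl⟩
        exact ⟨_, ⟨_, rfl⟩, rfl⟩
      · rw [Ideal.span_le]
        rintro _ ⟨_, ⟨j, rfl⟩, rfl⟩
        by_cases hj : j ∈ T
        · have : Ideal.Quotient.mk I (z j) = 0 :=
            Ideal.Quotient.eq_zero_iff_mem.mpr (Ideal.subset_span ⟨j, hj, rfl⟩)
          rw [this]
          exact zero_mem _
        · exact Ideal.subset_span ⟨e ⟨j, hj⟩, by simp [z']⟩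
    have hcard : Fintype.card σ = Fintype.card {i // i ∉ T} + Fintype.card {i // i ∈ T} := by
      rw [add_comm, Fintype.card_subtype_compl]
      have := Fintype.card_subtype_le (· ∈ T)
      omega
    have hdim' : ringKrullDim (R ⧸ I) = Fintype.card {i // i ∉ T} := by
      apply le_antisymm
      · refine (ringKrullDim_le_spanFinrank_maximalIdeal (R ⧸ I)).trans ?_
        rw [← hz']
        exact_mod_cast (spanFinrank_span_range_le z').trans (by simp)
      · have h1 := ringKrullDim_le_ringKrullDim_quotient_add_card (Finset.image z T.toFinset) (by
          rw [ringJacobson_eq_maximalIdeal]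
          intro x hx
          simp only [Finset.coe_image, Set.coe_toFinset] at hx
          obtain ⟨i, _, rfl⟩ := hx
          exact hzm i)
        have h2 : (Finset.image z T.toFinset).card ≤ Fintype.card {i // i ∈ T} :=
          Finset.card_image_le.trans (by rw [Set.toFinset_card])
        have hIT : Ideal.span ((Finset.image z T.toFinset : Finset R) : Set R) = I := by simp [I]
        rw [hIT] at h1
        have h3 : ringKrullDim R ≤ ringKrullDim (R ⧸ I) + Fintype.card {i // i ∈ T} :=
          h1.trans (add_le_add_right (by exact_mod_cast h2) _)
        rw [hdim, hcard] at h3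
        push_cast at h3
        exact (ENat.WithBot.add_le_add_natCast_right_iff).mp h3
    exact (Ideal.Quotient.isDomain_iff_prime I).mp
      (isDomain_of_span_range_eq_maximalIdeal _ _ z' hz' hdim')
  -- Otherwise `z i` would be redundant, leaving fewer generators of the maximal ideal than the
  -- dimension.
  · intro i hi hmem
    let y : {j // j ≠ i} → R := fun j ↦ z j.1
    have hy : Ideal.span (Set.range y) = maximalIdeal R := by
      rw [← hz]
      apply le_antisymm
      · apply Ideal.span_mono
        rintro _ ⟨j, rfl⟩
        exact ⟨_, rfl⟩
      · rw [Ideal.span_le]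
        rintro _ ⟨j, rfl⟩
        by_cases hj : j = i
        · subst hj
          refine Ideal.span_mono ?_ hmem
          rintro _ ⟨l, hl, rfl⟩
          exact ⟨⟨l, fun h ↦ hi (h ▸ hl)⟩, rfl⟩
        · exact Ideal.subset_span ⟨⟨j, hj⟩, rfl⟩
    have h1 := ringKrullDim_le_spanFinrank_maximalIdeal R
    rw [hdim, ← hy] at h1
    have h2 := spanFinrank_span_range_le y
    have h3 : Fintype.card σ ≤ (Ideal.span (Set.range y)).spanFinrank := by exact_mod_cast h1
    have h4 : Fintype.card {j // j ≠ i} < Fintype.card σ :=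
      Fintype.card_subtype_lt (x := i) (by simp)
    omega

end RegularLocalRing

/-! ### Ideals generated by powers of parameters -/

section ParameterPowers

variable {R : Type*} [CommRing R] {σ : Type*} {z : σ → R}

/-- Let the elements `z j` behave like part of a regular system of parameters. Then every element
outside the prime ideal `(z j)_{j ∈ T}` is a nonzerodivisor modulo `(z j ^ n j)_{j ∈ T}`. -/
theorem mem_span_pow_of_mul_mem
    (hz : ∀ T : Set σ, (Ideal.span (z '' T)).IsPrime ∧ ∀ i ∉ T, z i ∉ Ideal.span (z '' T)) (N : ℕ) :
    ∀ (T : Finset σ) (n : σ → ℕ), (∀ j ∈ T, 1 ≤ n j) → ∑ j ∈ T, n j = N →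
      ∀ u f : R, u ∉ Ideal.span (z '' T) → u * f ∈ Ideal.span ((fun j ↦ z j ^ n j) '' T) →
        f ∈ Ideal.span ((fun j ↦ z j ^ n j) '' T) := by
  classical
  induction N using Nat.strong_induction_on with
  | _ N ih =>
    intro T n hn hN u f hu huf
    by_cases hone : ∀ j ∈ T, n j = 1
    · have : (fun j ↦ z j ^ n j) '' (T : Set σ) = z '' T :=
        Set.image_congr fun j hj ↦ by simp [hone j hj]
      rw [this] at huf ⊢
      exact ((hz T).1.mem_or_mem huf).resolve_left hu
    · push Not at hone
      obtain ⟨j, hjT, hj⟩ := hone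
      have hj2 : 2 ≤ n j := by have := hn j hjT; omega
      obtain ⟨T', hjT', rfl⟩ : ∃ T', j ∉ T' ∧ insert j T' = T :=
        ⟨T.erase j, Finset.notMem_erase j T, Finset.insert_erase hjT⟩
      have hne : ∀ i ∈ T', i ≠ j := fun i hi h ↦ hjT' (h ▸ hi)
      have hsum : ∀ n' : σ → ℕ, (∀ i ∈ T', n' i = n i) → ∑ i ∈ insert j T', n' i =
          n' j + ∑ i ∈ T', n i := fun n' h ↦ by
        rw [Finset.sum_insert hjT', Finset.sum_congr rfl h]
      have hspan : ∀ (a : ℕ), (fun i ↦ z i ^ Function.update n j a i) '' (insert j T' : Finset σ) =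
          insert (z j ^ a) ((fun i ↦ z i ^ n i) '' T') := fun a ↦ by
        rw [Finset.coe_insert, Set.image_insert_eq]
        congr 1
        · simp
        · exact Set.image_congr fun i hi ↦ by simp [hne i hi]
      have hupd : ∀ a, 1 ≤ a → ∀ i ∈ insert j T', 1 ≤ Function.update n j a i := fun a ha i hi ↦ by
        by_cases h : i = j
        · simpa [h] using ha
        · simpa [h] using hn i hi
      have hN' := hsum n fun _ _ ↦ rfl
      have key : ∀ a, 1 ≤ a → a < n j → ∀ g,
          u * g ∈ Ideal.span (insert (z j ^ a) ((fun i ↦ z i ^ n i) '' T')) →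
            g ∈ Ideal.span (insert (z j ^ a) ((fun i ↦ z i ^ n i) '' T')) := fun a ha han g hg ↦ by
        rw [← hspan] at hg ⊢
        refine ih _ ?_ _ _ (hupd a ha) rfl u g hu hg
        rw [hsum _ fun i hi ↦ by simp [hne i hi], Function.update_self]
        omega
      have huf' : u * f ∈ Ideal.span (insert (z j ^ n j) ((fun i ↦ z i ^ n i) '' T')) := by
        rwa [Finset.coe_insert, Set.image_insert_eq] at huf
      rw [Finset.coe_insert, Set.image_insert_eq]
      have hpow : z j ^ n j = z j * z j ^ (n j - 1) := by
        rw [← pow_succ']; congr 1; omega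
      obtain ⟨h, k, hk, e⟩ := Ideal.mem_span_insert.mp huf'
      -- Lower the exponent at `j` to 1 to write `f = g * z j + l`. Cancelling `z j` modulo the
      -- other powers then puts `u * g` in the ideal with exponent `n j - 1`, where induction
      -- applies to `g`.
      have h1 := key 1 le_rfl (by omega) f (by
        rw [e, Ideal.mem_span_insert]
        exact ⟨h * z j ^ (n j - 1), k, hk, by rw [hpow]; ring⟩)
      obtain ⟨g, l, hl, e'⟩ := Ideal.mem_span_insert.mp h1
      have h2 : u * g - h * z j ^ (n j - 1) ∈ Ideal.span ((fun i ↦ z i ^ n i) '' T') := by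
        refine ih _ ?_ T' n (fun i hi ↦ hn i (Finset.mem_insert_of_mem hi)) rfl (z j) _
          ((hz T').2 j (by simpa using hjT')) ?_
        · omega
        · have : z j * (u * g - h * z j ^ (n j - 1)) = k - u * l := by
            rw [e', hpow] at e
            linear_combination e
          rw [this]
          exact sub_mem hk (Ideal.mul_mem_left _ _ hl)
      have h3 := key (n j - 1) (by omega) (by omega) g (by
        rw [Ideal.mem_span_insert]
        exact ⟨h, _, h2, by ring⟩)
      obtain ⟨g', l', hl', rfl⟩ := Ideal.mem_span_insert.mp h3
      rw [Ideal.mem_span_insert]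
      refine ⟨g', l + z j * l', add_mem hl (Ideal.mul_mem_left _ _ hl'), ?_⟩
      rw [e', hpow]
      ring

/-- For `T = T₀` this is the colon computation `(Q_k : z^k) ⊂ P`. Exponents are lowered one index at
a time: `z j ^ k j` is a nonzerodivisor modulo powers of the other parameters, so it cancels and
leaves `z j` in place of `z j ^ (k j + 1)`. -/
theorem mem_span_of_mul_prod_pow_mem
    (hz : ∀ T : Set σ, (Ideal.span (z '' T)).IsPrime ∧ ∀ i ∉ T, z i ∉ Ideal.span (z '' T))
    (T₀ : Finset σ) (k : σ → ℕ) (b : R) (T : Finset σ) (hT : T ⊆ T₀) :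
    ∀ e : σ → ℕ, (∀ j ∈ T, e j = k j + 1) → (∀ j ∈ T₀, j ∉ T → e j = 1) →
      b * ∏ j ∈ T, z j ^ k j ∈ Ideal.span ((fun j ↦ z j ^ e j) '' T₀) →
        b ∈ Ideal.span (z '' T₀) := by
  classical
  induction T using Finset.induction_on with
  | empty =>
    intro e _ h1 hb
    have : (fun j ↦ z j ^ e j) '' (T₀ : Set σ) = z '' T₀ :=
      Set.image_congr fun j hj ↦ by simp [h1 j hj]
    rw [this] at hb
    simpa using hb
  | insert j T hjT ih =>
    intro e hk h1 hb
    obtain ⟨T', hjT', rfl⟩ : ∃ T', j ∉ T' ∧ insert j T' = T₀ :=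
      ⟨T₀.erase j, Finset.notMem_erase j T₀, Finset.insert_erase (hT (Finset.mem_insert_self _ _))⟩
    have hne : ∀ i ∈ T', i ≠ j := fun i hi h ↦ hjT' (h ▸ hi)
    refine ih ((Finset.subset_insert _ _).trans hT) (Function.update e j 1) ?_ ?_ ?_
    · intro i hi
      rw [Function.update_of_ne (fun h : i = j ↦ hjT (h ▸ hi))]
      exact hk i (Finset.mem_insert_of_mem hi)
    · intro i hi hiT
      by_cases h : i = j
      · simp [h]
      · rw [Function.update_of_ne h]
        exact h1 i hi (by simp [h, hiT])
    · rw [Finset.prod_insert hjT] at hb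
      have himg : (fun i ↦ z i ^ Function.update e j 1 i) '' (T' : Set σ) =
          (fun i ↦ z i ^ e i) '' T' := Set.image_congr fun i hi ↦ by simp [hne i hi]
      rw [Finset.coe_insert, Set.image_insert_eq, Ideal.mem_span_insert] at hb ⊢
      rw [himg]
      obtain ⟨a, c, hc, h⟩ := hb
      refine ⟨a, b * ∏ i ∈ T, z i ^ k i - a * z j, ?_, by simp⟩
      refine mem_span_pow_of_mul_mem hz _ T' e ?_ rfl (z j ^ k j) _ ?_ ?_
      · intro i hi
        by_cases h : i ∈ T
        · rw [hk i (Finset.mem_insert_of_mem h)]; omega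
        · rw [h1 i (Finset.mem_insert_of_mem hi) (by simp [h, hne i hi])]
      · exact fun h ↦ (hz T').2 j (by simpa using hjT') ((hz T').1.mem_of_pow_mem _ h)
      · have : z j ^ k j * (b * ∏ i ∈ T, z i ^ k i - a * z j) = c := by
          rw [hk j (Finset.mem_insert_self _ _)] at h
          linear_combination h
        rwa [this]

end ParameterPowers

/-! ### The hull of an ideal in a local ring -/

section MonomialHull

variable {R : Type*} [CommRing R] {ι : Type*}

lemma sum_pow_le_of_forall [DecidableEq ι] (E : ι → Ideal R) (s : Finset ι) (n : ℕ) (K : Ideal R)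
    (h : ∀ k ∈ s.piAntidiag n, ∏ i ∈ s, E i ^ k i ≤ K) : (∑ i ∈ s, E i) ^ n ≤ K := by
  rw [Finset.sum_pow_eq_sum_piAntidiag, Ideal.sum_eq_sup, Finset.sup_le_iff]
  exact fun k hk ↦ Ideal.mul_le_right.trans (h k hk)

lemma span_image_eq_iSup {σ : Type*} (g : σ → R) (T : Set σ) :
    Ideal.span (g '' T) = ⨆ i ∈ T, Ideal.span {g i} := by
  rw [← Set.biUnion_of_singleton (g '' T), Ideal.span, Submodule.span_iUnion₂, iSup_image]

/-- The ideal `∑_{i ∈ S} E i ^ (m i + 1)`. -/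
def boxIdeal (E : ι → Ideal R) (S : Set ι) (m : ι → ℕ) : Ideal R :=
  ⨆ i ∈ S, E i ^ (m i + 1)

lemma boxIdeal_mono (E : ι → Ideal R) {S T : Set ι} (h : S ⊆ T) (m : ι → ℕ) :
    boxIdeal E S m ≤ boxIdeal E T m :=
  biSup_mono h

lemma boxIdeal_anti (E : ι → Ideal R) (S : Set ι) {m m' : ι → ℕ} (h : ∀ i ∈ S, m i ≤ m' i) :
    boxIdeal E S m' ≤ boxIdeal E S m :=
  iSup₂_mono fun i hi ↦ Ideal.pow_le_pow_right (Nat.succ_le_succ (h i hi))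

lemma map_boxIdeal {R' : Type*} [CommRing R'] (f : R →+* R') (E : ι → Ideal R) (S : Set ι)
    (m : ι → ℕ) : (boxIdeal E S m).map f = boxIdeal (fun i ↦ (E i).map f) S m := by
  simp [boxIdeal, Ideal.map_iSup, Ideal.map_pow]

variable {E : ι → Ideal R} {z : {i | E i ≠ ⊤} → R}

lemma boxIdeal_eq_span (hE : ∀ i, E i.1 = Ideal.span {z i}) (T : Set {i | E i ≠ ⊤}) (m : ι → ℕ) :
    boxIdeal E (Subtype.val '' T) m = Ideal.span ((fun j ↦ z j ^ (m j.1 + 1)) '' T) := by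
  rw [boxIdeal, iSup_image, span_image_eq_iSup]
  simp only [hE, Ideal.span_singleton_pow]

lemma iSup_eq_span (hE : ∀ i, E i.1 = Ideal.span {z i}) (T : Set {i | E i ≠ ⊤}) :
    ⨆ i ∈ Subtype.val '' T, E i = Ideal.span (z '' T) := by
  rw [iSup_image, span_image_eq_iSup]
  simp only [hE]

variable [Fintype ι]

lemma prod_pow_le_boxIdeal (E : ι → Ideal R) {S : Set ι} {m m' : ι → ℕ} {i : ι} (hi : i ∈ S)
    (h : m i < m' i) : ∏ i, E i ^ m' i ≤ boxIdeal E S m :=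
  calc ∏ i, E i ^ m' i ≤ E i ^ m' i :=
        Ideal.prod_le_inf.trans (Finset.inf_le (Finset.mem_univ i))
    _ ≤ E i ^ (m i + 1) := Ideal.pow_le_pow_right h
    _ ≤ boxIdeal E S m := le_iSup₂_of_le (f := fun i (_ : i ∈ S) ↦ E i ^ (m i + 1)) i hi le_rfl

/-- The smallest ideal containing `J` that is a sum of products of powers of the ideals `E i`. -/
def monomialHull (E : ι → Ideal R) (J : Ideal R) : Ideal R :=
  ⨆ m ∈ {m : ι → ℕ | ¬ J ≤ boxIdeal E {i | E i ≠ ⊤} m}, ∏ i, E i ^ m i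

/-- If no `b ∈ B` were bounded by `m` on the proper `E i`, every generator, hence `J`, would lie in
the box ideal of `m`. No regularity is needed. -/
lemma monomialHull_le {E : ι → Ideal R} {J : Ideal R} {B : Set (ι → ℕ)}
    (h : J ≤ ⨆ m ∈ B, ∏ i, E i ^ m i) : monomialHull E J ≤ ⨆ m ∈ B, ∏ i, E i ^ m i := by
  refine iSup₂_le fun m hm ↦ ?_
  obtain ⟨b, hb, hbm⟩ : ∃ b ∈ B, ∀ i ∈ {i | E i ≠ ⊤}, b i ≤ m i := by
    by_contra! hcon
    refine hm (h.trans (iSup₂_le fun b hb ↦ ?_))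
    obtain ⟨i, hi, hlt⟩ := hcon b hb
    exact prod_pow_le_boxIdeal E hi hlt
  refine le_iSup₂_of_le (f := fun m (_ : m ∈ B) ↦ ∏ i, E i ^ m i) b hb ?_
  refine Finset.prod_le_prod' fun i _ ↦ ?_
  by_cases hi : E i = ⊤
  · simp [hi, ← Ideal.one_eq_top]
  · exact Ideal.pow_le_pow_right (hbm i hi)

/-- A generator with exponents at most `m` would have a box ideal containing that of `m`, hence `J`,
against its choice. -/
lemma monomialHull_le_boxIdeal {E : ι → Ideal R} {J : Ideal R} {m : ι → ℕ}
    (h : J ≤ boxIdeal E {i | E i ≠ ⊤} m) :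
    monomialHull E J ≤ boxIdeal E {i | E i ≠ ⊤} m := by
  refine iSup₂_le fun m' hm' ↦ ?_
  by_contra hcon
  refine hm' (h.trans (boxIdeal_anti E _ fun i hi ↦ ?_))
  by_contra! hlt
  exact hcon (prod_pow_le_boxIdeal E hi hlt)

lemma monomialHull_le_pow {E : ι → Ideal R} {J 𝔪 : Ideal R} (h𝔪 : 𝔪 = ⨆ i ∈ {i | E i ≠ ⊤}, E i)
    {n : ℕ} (hJ : J ≤ 𝔪 ^ n) : monomialHull E J ≤ 𝔪 ^ n := by
  classical
  refine iSup₂_le fun m hm ↦ ?_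
  let s : Finset ι := Finset.univ.filter fun i ↦ E i ≠ ⊤
  have hs : 𝔪 = ∑ i ∈ s, E i := by
    rw [h𝔪, Ideal.sum_eq_sup, Finset.sup_eq_iSup]
    simp [s]
  by_cases hn : n ≤ ∑ i ∈ s, m i
  · calc ∏ i, E i ^ m i ≤ ∏ i, 𝔪 ^ (if i ∈ s then m i else 0) := by
          refine Finset.prod_le_prod' fun i _ ↦ ?_
          split_ifs with hi
          · refine Ideal.pow_right_mono ?_ _
            rw [hs, Ideal.sum_eq_sup]
            exact Finset.le_sup (f := E) hi
          · simp
      _ = 𝔪 ^ ∑ i ∈ s, m i := by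
          rw [Finset.prod_pow_eq_pow_sum]
          congr 1
          simp
      _ ≤ 𝔪 ^ n := Ideal.pow_le_pow_right hn
  -- A monomial of degree `n > ∑ m i` has some exponent above `m i`, so `𝔪 ^ n` lies in the box
  -- ideal of `m`.
  · refine absurd (hJ.trans ?_) hm
    rw [hs]
    refine sum_pow_le_of_forall E s n _ fun k hk ↦ ?_
    rw [Finset.mem_piAntidiag] at hk
    obtain ⟨i, hi, hlt⟩ : ∃ i ∈ s, m i < k i := by
      by_contra! hcon
      exact hn (hk.1 ▸ Finset.sum_le_sum hcon)
    refine le_trans (le_of_eq ?_) (prod_pow_le_boxIdeal E (m' := k) (i := i) (by simpa [s] using hi) hlt)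
    refine Finset.prod_subset (Finset.subset_univ _) fun j _ hj ↦ ?_
    have : k j = 0 := by
      by_contra h
      exact hj (hk.2 j h)
    simp [this]


/-- The ideal `∑_{i ∈ T} E i ^ (m i + 1)` is primary with radical `∑_{i ∈ T} E i`. -/
lemma mem_boxIdeal_of_mul_mem (hE : ∀ i, E i.1 = Ideal.span {z i})
    (hz : ∀ T, (Ideal.span (z '' T)).IsPrime ∧ ∀ i ∉ T, z i ∉ Ideal.span (z '' T))
    {T : Set ι} (hT : T ⊆ {i | E i ≠ ⊤}) (m : ι → ℕ) {u f : R} (hu : u ∉ ⨆ i ∈ T, E i)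
    (h : u * f ∈ boxIdeal E T m) : f ∈ boxIdeal E T m := by
  classical
  obtain ⟨T, rfl⟩ := Set.subset_range_iff_exists_image_eq.mp
    (hT.trans (Subtype.range_val (s := {i | E i ≠ ⊤})).ge)
  rw [iSup_eq_span hE] at hu
  rw [boxIdeal_eq_span hE] at h ⊢
  have := mem_span_pow_of_mul_mem hz _ T.toFinset (fun j ↦ m j.1 + 1) (by simp) rfl u f
  simp only [Set.coe_toFinset] at this
  exact this hu h

lemma le_monomialHull [IsLocalRing R] [IsNoetherianRing R] (hE : ∀ i, E i.1 = Ideal.span {z i})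
    (hz : ∀ T, (Ideal.span (z '' T)).IsPrime ∧ ∀ i ∉ T, z i ∉ Ideal.span (z '' T))
    (J : Ideal R) : J ≤ monomialHull E J := by
  classical
  intro f hf
  set P : Ideal R := Ideal.span (Set.range z) with hP
  have hP' : P = Ideal.span (z '' (Finset.univ : Finset {i | E i ≠ ⊤})) := by simp [hP]
  have hPprime : P.IsPrime := by rw [hP']; exact (hz _).1
  -- The value 0 is immaterial: powers of the unit ideal are the unit ideal.
  let ext : ({i | E i ≠ ⊤} → ℕ) → ι → ℕ := fun k i ↦ if h : E i ≠ ⊤ then k ⟨i, h⟩ else 0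
  have hext : ∀ k (i : {i | E i ≠ ⊤}), ext k i.1 = k i := fun k i ↦ dif_pos i.2
  have hprod : ∀ k, ∏ i, E i ^ ext k i = Ideal.span {∏ j, z j ^ k j} := fun k ↦ by
    rw [← Ideal.prod_span_singleton]
    simp_rw [← Ideal.span_singleton_pow, ← hE, ← hext k]
    rw [← Finset.prod_subtype (p := (· ∈ {i | E i ≠ ⊤}))
      (Finset.univ.filter fun i ↦ E i ≠ ⊤) (by simp) fun i ↦ E i ^ ext k i]
    refine (Finset.prod_filter_of_ne fun i _ h ↦ ?_).symm
    exact fun hi ↦ h (by simp [hi, ← Ideal.one_eq_top])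
  have hbox : ∀ k, boxIdeal E {i | E i ≠ ⊤} (ext k) =
      Ideal.span ((fun j ↦ z j ^ (k j + 1)) '' (Finset.univ : Finset {i | E i ≠ ⊤})) := fun k ↦ by
    have := boxIdeal_eq_span hE Set.univ (ext k)
    rw [Set.image_univ, Subtype.range_val] at this
    rw [this]
    simp only [hext, Finset.coe_univ]
  have key : ∀ N, f ∈ monomialHull E J ⊔ P ^ N := by
    intro N
    induction N with
    | zero => simp
    | succ N ih =>
      obtain ⟨g, hg, h, hh, rfl⟩ := Submodule.mem_sup.mp ih
      have hle : P ^ N ≤ Ideal.span ((fun k : {i | E i ≠ ⊤} → ℕ ↦ ∏ j, z j ^ k j) ''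
          ((Finset.univ.piAntidiag N : Finset ({i | E i ≠ ⊤} → ℕ)) : Set _)) := by
        have : P = ∑ j, Ideal.span {z j} := by
          rw [hP, Ideal.sum_eq_sup, Finset.sup_eq_iSup]
          simp [← Ideal.span_iUnion]
        rw [this]
        refine sum_pow_le_of_forall _ _ _ _ fun k hk ↦ ?_
        simp only [Ideal.span_singleton_pow, Ideal.prod_span_singleton]
        exact Ideal.span_mono (Set.singleton_subset_iff.mpr ⟨k, hk, rfl⟩)
      obtain ⟨b, rfl⟩ := (Submodule.mem_span_image_finset_iff_exists_fun R).mp (hle hh)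
      refine add_mem (Submodule.mem_sup_left hg) (Ideal.sum_mem _ fun ⟨k, hk⟩ _ ↦ ?_)
      by_cases hkA : J ≤ boxIdeal E {i | E i ≠ ⊤} (ext k)
      · refine Submodule.mem_sup_right ?_
        rw [pow_succ']
        refine Ideal.mul_mem_mul ?_ ?_
        · rw [hP']
          refine mem_span_of_mul_prod_pow_mem hz Finset.univ k (b ⟨k, hk⟩) Finset.univ subset_rfl
            (fun j ↦ k j + 1) (by simp) (by simp) ?_
          rw [← hbox]
          -- The homogeneous part of degree `N` lies in the box ideal of `k`. So does every other
          -- monomial of that degree, having an exponent above that of `k`; this isolates the term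
          -- of `k`.
          have h1 := sub_mem (hkA hf) (monomialHull_le_boxIdeal hkA hg)
          rw [add_sub_cancel_left, ← Finset.add_sum_erase _ _ (Finset.mem_univ ⟨k, hk⟩)] at h1
          refine (Ideal.add_mem_iff_left _ (Ideal.sum_mem _ fun ⟨k', hk'⟩ hne ↦ ?_)).mp h1
          obtain ⟨j, hj⟩ : ∃ j, k j < k' j := by
            by_contra! hcon
            refine (Finset.mem_erase.mp hne).1 (Subtype.ext (funext fun j ↦ ?_))
            rw [Finset.mem_piAntidiag] at hk hk'
            exact (Finset.sum_eq_sum_iff_of_le fun j _ ↦ hcon j).mp (hk'.1.trans hk.1.symm) j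
              (Finset.mem_univ j)
          refine Ideal.mul_mem_left _ _ ?_
          have h2 := prod_pow_le_boxIdeal E (m := ext k) (m' := ext k') (i := j.1) j.2
            (by rwa [hext, hext])
          rw [hprod] at h2
          exact h2 (Ideal.mem_span_singleton_self _)
        · change ∏ j, z j ^ k j ∈ P ^ N
          rw [← (Finset.mem_piAntidiag.mp hk).1, ← Finset.prod_pow_eq_pow_sum]
          exact Ideal.prod_mem_prod fun j _ ↦
            Ideal.pow_mem_pow (Ideal.subset_span (Set.mem_range_self j)) _
      · refine Submodule.mem_sup_left (Ideal.mul_mem_left _ _ ?_)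
        have := le_iSup₂_of_le (f := fun m (_ : m ∈ {m : ι → ℕ |
          ¬ J ≤ boxIdeal E {i | E i ≠ ⊤} m}) ↦ ∏ i, E i ^ m i) (ext k) hkA le_rfl
        rw [hprod] at this
        exact this (Ideal.mem_span_singleton_self _)
  -- Krull's intersection theorem: the quotient by the hull is `P`-adically separated.
  have hH := IsHausdorff.of_isLocalRing P (R ⧸ monomialHull E J) hPprime.ne_top
  rw [← Ideal.Quotient.eq_zero_iff_mem]
  refine hH.haus _ fun N ↦ ?_
  rw [SModEq.zero]
  obtain ⟨g, hg, h, hh, rfl⟩ := Submodule.mem_sup.mp (key N)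
  rw [map_add, Ideal.Quotient.eq_zero_iff_mem.mpr hg, zero_add]
  have : Ideal.Quotient.mk (monomialHull E J) h = h • (1 : R ⧸ monomialHull E J) := by
    rw [Algebra.smul_def, mul_one]; rfl
  rw [this]
  exact Submodule.smul_mem_smul hh trivial

end MonomialHull

/-! ### Ideal sheaves through their stalks -/

section Stalks

variable {X : Scheme.{u}} {ι : Type v}

lemma germ_mem_map_iff {V : X.Opens} (hV : IsAffineOpen V) {x : X} (hx : x ∈ V)
    (K : Ideal Γ(X, V)) (f : Γ(X, V)) :
    X.presheaf.germ V x hx f ∈ K.map (X.presheaf.germ V x hx).hom ↔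
      ∃ s : Γ(X, V), x ∈ X.basicOpen s ∧ s * f ∈ K := by
  let := X.presheaf.algebra_section_stalk ⟨x, hx⟩
  have := hV.isLocalization_stalk ⟨x, hx⟩
  refine (IsLocalization.algebraMap_mem_map_algebraMap_iff
    (hV.primeIdealOf ⟨x, hx⟩).asIdeal.primeCompl _ K f).trans ?_
  refine exists_congr fun s ↦ and_congr_left' ?_
  rw [X.mem_basicOpen s x hx]
  exact (IsLocalization.AtPrime.isUnit_to_map_iff (X.presheaf.stalk x)
    (hV.primeIdealOf ⟨x, hx⟩).asIdeal s).symm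

lemma exists_mul_eq_germ {V : X.Opens} (hV : IsAffineOpen V) {x : X} (hx : x ∈ V)
    (f : X.presheaf.stalk x) : ∃ s a : Γ(X, V), x ∈ X.basicOpen s ∧
      X.presheaf.germ V x hx s * f = X.presheaf.germ V x hx a := by
  let := X.presheaf.algebra_section_stalk ⟨x, hx⟩
  have := hV.isLocalization_stalk ⟨x, hx⟩
  obtain ⟨⟨a, s⟩, h⟩ := IsLocalization.surj (hV.primeIdealOf ⟨x, hx⟩).asIdeal.primeCompl f
  refine ⟨s, a, ?_, (mul_comm _ _).trans h⟩
  rw [X.mem_basicOpen s.1 x hx]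
  exact (IsLocalization.AtPrime.isUnit_to_map_iff (X.presheaf.stalk x)
    (hV.primeIdealOf ⟨x, hx⟩).asIdeal s.1).mpr s.2

lemma map_comap_germ {V : X.Opens} (hV : IsAffineOpen V) {x : X} (hx : x ∈ V)
    (K : Ideal (X.presheaf.stalk x)) :
    (K.comap (X.presheaf.germ V x hx).hom).map (X.presheaf.germ V x hx).hom = K := by
  let := X.presheaf.algebra_section_stalk ⟨x, hx⟩
  have := hV.isLocalization_stalk ⟨x, hx⟩
  exact IsLocalization.map_under (hV.primeIdealOf ⟨x, hx⟩).asIdeal.primeCompl _ K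

/-- The local ring at `η` is a localization of the one at `x`; denominators are cleared through
sections on an affine neighbourhood of `x`. -/
lemma exists_mul_mem_of_stalkSpecializes_mem {η x : X} (h : η ⤳ x)
    (K : Ideal (X.presheaf.stalk x)) (f : X.presheaf.stalk x)
    (hf : (X.presheaf.stalkSpecializes h).hom f ∈ K.map (X.presheaf.stalkSpecializes h).hom) :
    ∃ w, IsUnit ((X.presheaf.stalkSpecializes h).hom w) ∧ w * f ∈ K := by
  obtain ⟨V, hV, hx, -⟩ := exists_isAffineOpen_mem_and_subset (U := ⊤) (x := x) (by simp)
  have hη : η ∈ V := h.mem_open V.2 hx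
  have hgerm : ∀ a, (X.presheaf.stalkSpecializes h).hom (X.presheaf.germ V x hx a) =
      X.presheaf.germ V η hη a := fun a ↦ by
    rw [← X.presheaf.germ_stalkSpecializes hx h]; rfl
  obtain ⟨s, a, hs, hsa⟩ := exists_mul_eq_germ hV hx f
  rw [X.mem_basicOpen s x hx] at hs
  have ha : X.presheaf.germ V η hη a ∈
      (K.comap (X.presheaf.germ V x hx).hom).map (X.presheaf.germ V η hη).hom := by
    rw [← X.presheaf.germ_stalkSpecializes hx h, CommRingCat.hom_comp, ← Ideal.map_map,
      map_comap_germ hV hx, CommRingCat.comp_apply, ← hsa, map_mul]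
    exact Ideal.mul_mem_left _ _ hf
  obtain ⟨t, ht, hta⟩ := (germ_mem_map_iff hV hη _ a).mp ha
  rw [X.mem_basicOpen t η hη, ← hgerm] at ht
  refine ⟨X.presheaf.germ V x hx t * X.presheaf.germ V x hx s, ?_, ?_⟩
  · rw [map_mul]
    exact ht.mul (hs.map _)
  · rw [mul_assoc, hsa, ← map_mul]
    exact hta

lemma stalkIdeal_eq_map (I : X.IdealSheafData) (V : X.affineOpens) {x : X} (hx : x ∈ V.1) :
    stalkIdeal I x = (I.ideal V).map (X.presheaf.germ V.1 x hx).hom := by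
  have key : ∀ (U W : X.affineOpens) (hW : x ∈ W.1) (h : W ≤ U),
      (I.ideal U).map (X.presheaf.germ U.1 x (h hW)).hom =
        (I.ideal W).map (X.presheaf.germ W.1 x hW).hom := fun U W hW h ↦ by
    have hle : W.1 ≤ U.1 := h
    rw [← X.presheaf.germ_res (homOfLE hle) x hW, CommRingCat.hom_comp, ← Ideal.map_map]
    exact congrArg _ (I.map_ideal h)
  refine le_antisymm (iSup₂_le fun U hU ↦ ?_) (le_iSup₂_of_le (f := fun (U : X.affineOpens)
    (hx : x ∈ U.1) ↦ (I.ideal U).map (X.presheaf.germ U.1 x hx).hom) V hx le_rfl)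
  obtain ⟨W, hW, hxW, hle⟩ := exists_isAffineOpen_mem_and_subset (U := U.1 ⊓ V.1) (x := x) ⟨hU, hx⟩
  have hWU : (⟨W, hW⟩ : X.affineOpens) ≤ U := fun y hy ↦ (hle hy).1
  have hWV : (⟨W, hW⟩ : X.affineOpens) ≤ V := fun y hy ↦ (hle hy).2
  exact ((key U ⟨W, hW⟩ hxW hWU).trans (key V ⟨W, hW⟩ hxW hWV).symm).le

lemma exists_affineOpens_mem {U : X.Opens} {x : X} (hx : x ∈ U) :
    ∃ V : X.affineOpens, x ∈ V.1 ∧ V.1 ≤ U := by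
  obtain ⟨V, hV, hxV, hle⟩ := exists_isAffineOpen_mem_and_subset hx
  exact ⟨⟨V, hV⟩, hxV, hle⟩

lemma stalkIdeal_mono {I J : X.IdealSheafData} (h : I ≤ J) (x : X) :
    stalkIdeal I x ≤ stalkIdeal J x :=
  iSup₂_mono fun U _ ↦ Ideal.map_mono (h U)

lemma le_of_stalkIdeal_le {I J : X.IdealSheafData} (h : ∀ x, stalkIdeal I x ≤ stalkIdeal J x) :
    I ≤ J := fun V ↦ V.2.ideal_le_iff.mpr fun x hx ↦ by
  rw [← stalkIdeal_eq_map, ← stalkIdeal_eq_map]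
  exact h x

lemma eqOn_iff {I J : X.IdealSheafData} {U : X.Opens} :
    EqOn I J U ↔ ∀ x ∈ U, stalkIdeal I x = stalkIdeal J x := by
  refine ⟨fun h x hx ↦ ?_, fun h V hVU ↦ V.2.ideal_ext_iff.mpr fun x hx ↦ ?_⟩
  · obtain ⟨V, hxV, hV⟩ := exists_affineOpens_mem hx
    rw [stalkIdeal_eq_map I V hxV, stalkIdeal_eq_map J V hxV, h V hV]
  · rw [← stalkIdeal_eq_map, ← stalkIdeal_eq_map]
    exact h x (hVU hx)

lemma stalkIdeal_iSup {κ : Sort*} (I : κ → X.IdealSheafData) (x : X) :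
    stalkIdeal (⨆ i, I i) x = ⨆ i, stalkIdeal (I i) x := by
  obtain ⟨V, hx, -⟩ := exists_affineOpens_mem (U := ⊤) (x := x) (by simp)
  simp only [stalkIdeal_eq_map _ V hx]
  rw [iSup, Scheme.IdealSheafData.ideal_sSup, ← Set.range_comp, sSup_range, iSup_apply,
    Ideal.map_iSup]
  rfl

lemma stalkIdeal_prod_pow [Fintype ι] (D : ι → X.IdealSheafData) (m : ι → ℕ) (x : X) :
    stalkIdeal (monomialIdeal D m) x = ∏ i, stalkIdeal (D i) x ^ m i := by
  obtain ⟨V, hx, -⟩ := exists_affineOpens_mem (U := ⊤) (x := x) (by simp)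
  let F : X.IdealSheafData →* Ideal (X.presheaf.stalk x) :=
    { toFun := fun I ↦ stalkIdeal I x
      map_one' := by
        rw [stalkIdeal_eq_map _ V hx, Scheme.IdealSheafData.one_eq_top,
          Scheme.IdealSheafData.ideal_top, Pi.top_apply, Ideal.map_top, Ideal.one_eq_top]
      map_mul' := fun I J ↦ by
        simp only [stalkIdeal_eq_map _ V hx]
        rw [Scheme.IdealSheafData.ideal_mul, Pi.mul_apply, Ideal.map_mul] }
  exact (map_prod F _ _).trans (Finset.prod_congr rfl fun i _ ↦ map_pow F _ _)

lemma mem_support_iff_stalkIdeal_ne_top {I : X.IdealSheafData} {x : X} :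
    x ∈ I.support ↔ stalkIdeal I x ≠ ⊤ := by
  obtain ⟨V, hx, -⟩ := exists_affineOpens_mem (U := ⊤) (x := x) (by simp)
  rw [Scheme.IdealSheafData.mem_support_iff_of_mem hx, stalkIdeal_eq_map _ V hx,
    Scheme.mem_zeroLocus_iff]
  constructor
  · intro h htop
    have : (I.ideal V).map (X.presheaf.germ V.1 x hx).hom ≤
        IsLocalRing.maximalIdeal (X.presheaf.stalk x) := by
      rw [Ideal.map_le_iff_le_comap]
      intro f hf
      have := h f hf
      rwa [X.mem_basicOpen f x hx] at this
    exact (IsLocalRing.maximalIdeal.isMaximal _).ne_top (top_le_iff.mp (htop ▸ this))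
  · intro h f hf hxf
    rw [X.mem_basicOpen f x hx] at hxf
    exact h (Ideal.eq_top_of_isUnit_mem _ (Ideal.mem_map_of_mem _ hf) hxf)

lemma map_stalkIdeal_stalkSpecializes (I : X.IdealSheafData) {η x : X} (h : η ⤳ x) :
    (stalkIdeal I x).map (X.presheaf.stalkSpecializes h).hom = stalkIdeal I η := by
  obtain ⟨V, hx, -⟩ := exists_affineOpens_mem (U := ⊤) (x := x) (by simp)
  rw [stalkIdeal_eq_map I V hx, stalkIdeal_eq_map I V (h.mem_open V.1.2 hx), Ideal.map_map,
    ← CommRingCat.hom_comp, X.presheaf.germ_stalkSpecializes]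

/-- An inclusion of stalks of ideal sheaves spreads to a neighbourhood. -/
lemma exists_stalkIdeal_le [IsLocallyNoetherian X] {I J : X.IdealSheafData} {x : X}
    (h : stalkIdeal J x ≤ stalkIdeal I x) :
    ∃ U : X.Opens, x ∈ U ∧ ∀ y ∈ U, stalkIdeal J y ≤ stalkIdeal I y := by
  classical
  obtain ⟨V, hx, -⟩ := exists_affineOpens_mem (U := ⊤) (x := x) (by simp)
  have : IsNoetherianRing Γ(X, V.1) := IsLocallyNoetherian.component_noetherian V
  obtain ⟨t, ht⟩ := IsNoetherian.noetherian (J.ideal V)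
  rw [stalkIdeal_eq_map J V hx, stalkIdeal_eq_map I V hx] at h
  have : ∀ f ∈ t, ∃ s : Γ(X, V.1), x ∈ X.basicOpen s ∧ s * f ∈ I.ideal V := fun f hf ↦
    (germ_mem_map_iff V.2 hx _ f).mp (h (Ideal.mem_map_of_mem _ (ht ▸ Ideal.subset_span hf)))
  choose! s hs hsf using this
  refine ⟨X.basicOpen (∏ f ∈ t, s f), ?_, fun y hy ↦ ?_⟩
  · rw [X.mem_basicOpen _ x hx, map_prod]
    exact IsUnit.prod_iff.mpr fun f hf ↦ (X.mem_basicOpen _ x hx).mp (hs f hf)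
  · have hyV : y ∈ V.1 := X.basicOpen_le _ hy
    rw [stalkIdeal_eq_map J V hyV, stalkIdeal_eq_map I V hyV, Ideal.map_le_iff_le_comap, ← ht,
      Ideal.span_le]
    intro f hf
    refine (germ_mem_map_iff V.2 hyV _ f).mpr ⟨_, hy, ?_⟩
    rw [← Finset.prod_erase_mul _ _ hf, mul_assoc]
    exact Ideal.mul_mem_left _ _ (hsf f hf)

lemma exists_pow_mul_mem (I : X.IdealSheafData) (V : X.affineOpens) (h f : Γ(X, V.1))
    (hf : ∀ (y : X) (hy : y ∈ X.basicOpen h),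
      X.presheaf.germ V.1 y (X.basicOpen_le h hy) f ∈ stalkIdeal I y) :
    ∃ n : ℕ, h ^ n * f ∈ I.ideal V := by
  have := V.2.isLocalization_basicOpen h
  have h1 : X.presheaf.map (homOfLE (X.basicOpen_le h)).op f ∈
      (I.ideal V).map (X.presheaf.map (homOfLE (X.basicOpen_le h)).op).hom := by
    rw [I.map_ideal_basicOpen]
    refine (V.2.basicOpen h).mem_ideal_iff.mpr fun y hy ↦ ?_
    refine (stalkIdeal_eq_map I (X.affineBasicOpen h) hy).le ?_
    rw [X.presheaf.germ_res_apply]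
    exact hf y hy
  obtain ⟨_, ⟨n, rfl⟩, hn⟩ := (IsLocalization.algebraMap_mem_map_algebraMap_iff
    (.powers h) Γ(X, X.basicOpen h) _ f).mp h1
  exact ⟨n, hn⟩

/-- A family of ideals of the local rings which locally is the family of stalks of
an ideal sheaf is the family of stalks of an ideal sheaf. -/
theorem exists_stalkIdeal_eq (M : ∀ x : X, Ideal (X.presheaf.stalk x))
    (hM : ∀ x, ∃ U : X.Opens, x ∈ U ∧ ∃ I : X.IdealSheafData, ∀ y ∈ U, stalkIdeal I y = M y) :
    ∃ K : X.IdealSheafData, ∀ x, stalkIdeal K x = M x := by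
  classical
  let 𝔞 : ∀ V : X.affineOpens, Ideal Γ(X, V.1) := fun V ↦
    ⨅ (x : X) (hx : x ∈ V.1), (M x).comap (X.presheaf.germ V.1 x hx).hom
  have mem𝔞 : ∀ (V : X.affineOpens) (f : Γ(X, V.1)), f ∈ 𝔞 V ↔
      ∀ (x : X) (hx : x ∈ V.1), X.presheaf.germ V.1 x hx f ∈ M x := fun V f ↦ by
    simp [𝔞, Ideal.mem_comap]
  -- Quasi-coherence of `𝔞`. The nontrivial inclusion extends a local section: finitely many basic
  -- opens, each with a sheaf inducing `M`, cover `V`, and one power of `g₀` clears all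
  -- denominators.
  have key : ∀ (V : X.affineOpens) (x : X) (hx : x ∈ V.1),
      (𝔞 V).map (X.presheaf.germ V.1 x hx).hom = M x := by
    intro V x hx
    refine le_antisymm (Ideal.map_le_iff_le_comap.mpr fun f hf ↦ (mem𝔞 V f).mp hf x hx) ?_
    have hloc : ∀ y : V.1, ∃ (g : Γ(X, V.1)) (I : X.IdealSheafData), y.1 ∈ X.basicOpen g ∧
        ∀ w ∈ X.basicOpen g, stalkIdeal I w = M w := by
      rintro ⟨y, hy⟩
      obtain ⟨U, hyU, I, hI⟩ := hM y
      obtain ⟨g, hg, hyg⟩ := V.2.exists_basicOpen_le ⟨y, hyU⟩ hy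
      exact ⟨g, I, hyg, fun w hw ↦ hI w (hg hw)⟩
    choose g I hg hI using hloc
    obtain ⟨t, ht⟩ := V.2.isCompact.elim_finite_subcover (fun y ↦ (X.basicOpen (g y) : Set X))
      (fun y ↦ (X.basicOpen (g y)).2) fun y hy ↦ Set.mem_iUnion.mpr ⟨⟨y, hy⟩, hg ⟨y, hy⟩⟩
    rw [← hI ⟨x, hx⟩ x (hg ⟨x, hx⟩), stalkIdeal_eq_map _ V hx, Ideal.map_le_iff_le_comap]
    intro f hf
    set g₀ := g ⟨x, hx⟩
    have hpow : ∀ y, ∃ n : ℕ, (g₀ * g y) ^ n * f ∈ (I y).ideal V := fun y ↦ by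
      refine exists_pow_mul_mem (I y) V _ f fun w hw ↦ ?_
      rw [Scheme.basicOpen_mul] at hw
      rw [hI y w hw.2, ← hI ⟨x, hx⟩ w hw.1, stalkIdeal_eq_map _ V (X.basicOpen_le _ hw.1)]
      exact Ideal.mem_map_of_mem _ hf
    choose n hn using hpow
    refine (germ_mem_map_iff V.2 hx _ f).mpr ⟨g₀ ^ t.sup n, ?_, ?_⟩
    · have := (X.mem_basicOpen g₀ x hx).mp (hg ⟨x, hx⟩)
      rw [X.mem_basicOpen _ x hx, map_pow]
      exact this.pow _
    · rw [mem𝔞]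
      intro w hw
      obtain ⟨y, hyt, hwy⟩ := Set.mem_iUnion₂.mp (ht hw)
      rw [← hI y w hwy, stalkIdeal_eq_map _ V hw]
      refine (germ_mem_map_iff V.2 hw _ _).mpr ⟨g y ^ n y, ?_, ?_⟩
      · have := (X.mem_basicOpen (g y) w hw).mp hwy
        rw [X.mem_basicOpen _ w hw, map_pow]
        exact this.pow _
      · obtain ⟨d, hd⟩ := Nat.exists_eq_add_of_le (Finset.le_sup (f := n) hyt)
        have : g y ^ n y * (g₀ ^ t.sup n * f) = g₀ ^ d * ((g₀ * g y) ^ n y * f) := by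
          rw [hd]; ring
        rw [this]
        exact Ideal.mul_mem_left _ _ (hn y)
  let K : X.IdealSheafData :=
    { ideal := 𝔞
      map_ideal_basicOpen := fun V f ↦ by
        refine (V.2.basicOpen f).ideal_ext_iff.mpr fun x hx ↦ ?_
        rw [Ideal.map_map, ← CommRingCat.hom_comp, X.presheaf.germ_res, key]
        exact (key (X.affineBasicOpen f) x hx).symm }
  refine ⟨K, fun x ↦ ?_⟩
  obtain ⟨V, hx, -⟩ := exists_affineOpens_mem (U := ⊤) (x := x) (by simp)
  rw [stalkIdeal_eq_map K V hx]
  exact key V x hx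

end Stalks

/-! ### Strata and gluing of the local hulls -/

section Hull

open Topology

variable {X : Scheme.{u}} {ι : Type v}

lemma IsSNC.exists_generators [IsLocallyNoetherian X] {D : ι → X.IdealSheafData} (hD : IsSNC D)
    (x : X) : ∃ w : {i | stalkIdeal (D i) x ≠ ⊤} → X.presheaf.stalk x,
      (∀ i, stalkIdeal (D i.1) x = Ideal.span {w i}) ∧
      ∀ T, (Ideal.span (w '' T)).IsPrime ∧ ∀ i ∉ T, w i ∉ Ideal.span (w '' T) := by
  obtain ⟨n, z, c, hdim, hz, hc, hDz⟩ := hD.exists_coordinates x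
  let c' : {i | stalkIdeal (D i) x ≠ ⊤} → Fin n :=
    fun i ↦ c ⟨i.1, mem_support_iff_stalkIdeal_ne_top.mpr i.2⟩
  have hc' : Function.Injective c' := fun i j h ↦ Subtype.ext (congrArg Subtype.val (hc h) :)
  refine ⟨z ∘ c', fun i ↦ hDz ⟨i.1, _⟩, fun T ↦ ?_⟩
  rw [Set.image_comp]
  have := isPrime_span_image_of_regularParameters z hz (by simpa using hdim) (c' '' T)
  exact ⟨this.1, fun i hi ↦ this.2 _ fun h ↦ hi ((hc'.mem_set_image).mp h)⟩

/-- Let `Z` be a closed subset of a noetherian sober space. Near `x`, every point of `Z` has a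
common generalization with `x` that lies in `Z`. -/
lemma eventually_exists_generalization {Y : Type*} [TopologicalSpace Y]
    [TopologicalSpace.NoetherianSpace Y] [QuasiSober Y] {Z : Set Y} (hZ : IsClosed Z) (x : Y) :
    ∀ᶠ y in 𝓝 x, y ∈ Z → ∃ η ∈ Z, η ⤳ x ∧ η ⤳ y := by
  obtain ⟨S, hS, hcl, hirr, rfl⟩ :=
    TopologicalSpace.NoetherianSpace.exists_finite_set_isClosed_irreducible hZ
  have hev : ∀ᶠ y in 𝓝 x, ∀ C ∈ S, x ∉ C → y ∉ C := by
    rw [Filter.eventually_all_finite hS]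
    intro C hC
    by_cases hx : x ∈ C
    · simp [hx]
    · filter_upwards [(hcl C hC).isOpen_compl.mem_nhds hx] with y hy _ using hy
  -- Close to `x` only the irreducible pieces of `Z` through `x` remain; the generic point of one
  -- containing `y` serves.
  filter_upwards [hev] with y hy hyZ
  obtain ⟨C, hC, hyC⟩ := hyZ
  have hxC : x ∈ C := by
    by_contra h
    exact hy C hC h hyC
  have hgen := (hirr C hC).closure_genericPoint (hcl C hC)
  refine ⟨(hirr C hC).genericPoint,
    ⟨C, hC, ((hirr C hC).isGenericPoint_genericPoint (hcl C hC)).mem⟩, ?_, ?_⟩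
  · rw [specializes_iff_mem_closure, hgen]; exact hxC
  · rw [specializes_iff_mem_closure, hgen]; exact hyC

/-- Every prime ideal of the local ring at `x` comes from a generalization of `x`. -/
lemma exists_specializes_of_isPrime (x : X) (P : Ideal (X.presheaf.stalk x)) [hP : P.IsPrime] :
    ∃ y : X, y ⤳ x ∧ (∀ I : X.IdealSheafData, stalkIdeal I x ≤ P → y ∈ I.support) ∧
      (y = x → P = IsLocalRing.maximalIdeal (X.presheaf.stalk x)) := by
  obtain ⟨V, hx, -⟩ := exists_affineOpens_mem (U := ⊤) (x := x) (by simp)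
  let p : PrimeSpectrum Γ(X, V.1) := ⟨P.comap (X.presheaf.germ V.1 x hx).hom, inferInstance⟩
  let y : X := V.2.fromSpec p
  have hy : ∀ f : Γ(X, V.1), y ∈ X.basicOpen f ↔ X.presheaf.germ V.1 x hx f ∉ P := fun f ↦ by
    have : p ∈ V.2.fromSpec ⁻¹ᵁ X.basicOpen f ↔ p ∈ PrimeSpectrum.basicOpen f := by
      rw [V.2.fromSpec_preimage_basicOpen]
      exact Iff.rfl
    exact this
  have hyV : y ∈ V.1 := X.basicOpen_le 1 ((hy 1).mpr (by
    rw [map_one]; exact (Ideal.ne_top_iff_one P).mp hP.ne_top))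
  refine ⟨y, ?_, fun I hI ↦ ?_, fun h ↦ ?_⟩
  · rw [specializes_iff_forall_open]
    intro O hO hxO
    obtain ⟨f, hf, hxf⟩ := V.2.exists_basicOpen_le (V := ⟨O, hO⟩) ⟨x, hxO⟩ hx
    refine hf ((hy f).mpr fun hfP ↦ hP.ne_top ?_)
    exact Ideal.eq_top_of_isUnit_mem _ hfP ((X.mem_basicOpen f x hx).mp hxf)
  · rw [Scheme.IdealSheafData.mem_support_iff_of_mem hyV, Scheme.mem_zeroLocus_iff]
    intro f hf hyf
    refine (hy f).mp hyf (hI ?_)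
    rw [stalkIdeal_eq_map I V hx]
    exact Ideal.mem_map_of_mem _ hf
  · refine le_antisymm (IsLocalRing.le_maximalIdeal hP.ne_top) fun a ha ↦ ?_
    obtain ⟨s, b, hs, hsb⟩ := exists_mul_eq_germ V.2 hx a
    rw [X.mem_basicOpen s x hx] at hs
    rw [← Ideal.unit_mul_mem_iff_mem _ hs, hsb]
    by_contra hb
    rw [← hy, h, X.mem_basicOpen b x hx, ← hsb] at hb
    exact (IsLocalRing.mem_maximalIdeal a).mp ha (isUnit_of_mul_isUnit_right hb)

/-- At the generic point of a stratum, the maximal ideal is generated by the equations of the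
components of the divisor. -/
lemma IsStratum.maximalIdeal_eq [IsLocallyNoetherian X] {D : ι → X.IdealSheafData}
    (hD : IsSNC D) {W : Set X} (hW : IsStratum D W) :
    IsLocalRing.maximalIdeal (X.presheaf.stalk hW.isIrreducible.genericPoint) =
      ⨆ i ∈ {i | stalkIdeal (D i) hW.isIrreducible.genericPoint ≠ ⊤},
        stalkIdeal (D i) hW.isIrreducible.genericPoint := by
  set η := hW.isIrreducible.genericPoint with hη
  obtain ⟨T, hT⟩ := id hW
  have hclosed : IsClosed (⋂ i ∈ T, ((D i).support : Set X)) :=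
    isClosed_biInter fun i _ ↦ (D i).support.isClosed
  have hWcl : closure W = W := (hT.eq_of_le
    ⟨hT.prop.1.closure, closure_minimal hT.prop.2 hclosed⟩ subset_closure).symm
  have hgen : closure {η} = W := hW.isIrreducible.genericPoint_closure_eq.trans hWcl
  have hηW : η ∈ W := hgen ▸ subset_closure (Set.mem_singleton η)
  obtain ⟨w, hw, hz⟩ := hD.exists_generators η
  have hspan := iSup_eq_span (E := fun i ↦ stalkIdeal (D i) η) hw Set.univ
  rw [Set.image_univ, Subtype.range_val] at hspan
  have hprime : (⨆ i ∈ {i | stalkIdeal (D i) η ≠ ⊤}, stalkIdeal (D i) η).IsPrime := by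
    rw [hspan]; exact (hz _).1
  -- The point `y` still lies on all `D i` with `i ∈ T`, so maximality of `W` forces `closure {y} =
  -- W` and `y = η`.
  obtain ⟨y, hyη, hy, heq⟩ := exists_specializes_of_isPrime η _ (hP := hprime)
  refine (heq ?_).symm
  have hyT : closure {y} ⊆ ⋂ i ∈ T, ((D i).support : Set X) := by
    refine closure_minimal (Set.singleton_subset_iff.mpr (Set.mem_iInter₂.mpr fun i hi ↦ ?_)) hclosed
    refine hy (D i) (le_iSup₂_of_le (f := fun i (_ : i ∈ {i | stalkIdeal (D i) η ≠ ⊤}) ↦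
      stalkIdeal (D i) η) i ?_ le_rfl)
    exact mem_support_iff_stalkIdeal_ne_top.mp (Set.mem_iInter₂.mp (hT.prop.2 hηW) i hi)
  have hWy : W = closure {y} := hT.eq_of_le ⟨isIrreducible_singleton.closure, hyT⟩ (by
    rw [← hgen]
    exact closure_minimal (Set.singleton_subset_iff.mpr hyη.mem_closure) isClosed_closure)
  refine hyη.antisymm ?_ |>.eq
  rw [specializes_iff_mem_closure, hgen, hWy]
  exact subset_closure (Set.mem_singleton y)

variable [Fintype ι]

lemma stalkIdeal_iSup_monomialIdeal (D : ι → X.IdealSheafData) (S : Set (ι → ℕ)) (x : X) :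
    stalkIdeal (⨆ m ∈ S, monomialIdeal D m) x = ⨆ m ∈ S, ∏ i, stalkIdeal (D i) x ^ m i := by
  simp only [stalkIdeal_iSup, stalkIdeal_prod_pow]

/-- Near every point, the monomial hulls of the stalks of `J` are the stalks of a sum of
monomial ideal sheaves. -/
theorem exists_stalkIdeal_eq_monomialHull [IsNoetherian X] {D : ι → X.IdealSheafData}
    (hD : IsSNC D) (J : X.IdealSheafData) (x : X) :
    ∃ U : X.Opens, x ∈ U ∧ ∃ S : Set (ι → ℕ), ∀ y ∈ U,
      stalkIdeal (⨆ m ∈ S, monomialIdeal D m) y =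
        monomialHull (fun i ↦ stalkIdeal (D i) y) (stalkIdeal J y) := by
  classical
  let E : ∀ y : X, ι → Ideal (X.presheaf.stalk y) := fun y i ↦ stalkIdeal (D i) y
  -- The exponents of the hull at `x`, to be reused at all nearby points.
  let S : Set (ι → ℕ) := {m | ¬ stalkIdeal J x ≤ boxIdeal (E x) {i | E x i ≠ ⊤} m}
  obtain ⟨w, hw, hz⟩ := hD.exists_generators x
  have hJx : stalkIdeal J x ≤ stalkIdeal (⨆ m ∈ S, monomialIdeal D m) x := by
    rw [stalkIdeal_iSup_monomialIdeal]
    exact le_monomialHull (E := E x) hw hz _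
  obtain ⟨U₁, hxU₁, hU₁⟩ := exists_stalkIdeal_le hJx
  have hev : ∀ᶠ y in 𝓝 x, ∀ T : Set ι, y ∈ ⋂ i ∈ T, ((D i).support : Set X) →
      ∃ η ∈ ⋂ i ∈ T, ((D i).support : Set X), η ⤳ x ∧ η ⤳ y :=
    Filter.eventually_all.mpr fun T ↦ eventually_exists_generalization
      (isClosed_biInter fun i _ ↦ (D i).support.isClosed) x
  obtain ⟨U₂, hU₂, hU₂o, hxU₂⟩ := mem_nhds_iff.mp hev
  refine ⟨U₁ ⊓ ⟨U₂, hU₂o⟩, ⟨hxU₁, hxU₂⟩, S, fun y hy ↦ le_antisymm ?_ ?_⟩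
  · rw [stalkIdeal_iSup_monomialIdeal]
    refine iSup₂_le fun m hm ↦ le_iSup₂_of_le (f := fun m (_ : m ∈ {m : ι → ℕ |
      ¬ stalkIdeal J y ≤ boxIdeal (E y) {i | E y i ≠ ⊤} m}) ↦ ∏ i, E y i ^ m i) m ?_ le_rfl
    intro hle
    -- A containment in the box ideal at `y` is carried to `x` through `η`, which lies on every
    -- component through `y`: localize from `y` to `η`, then contract to `x`.
    obtain ⟨η, hη, hηx, hηy⟩ := hU₂ hy.2 {i | E y i ≠ ⊤}
      (Set.mem_iInter₂.mpr fun i hi ↦ mem_support_iff_stalkIdeal_ne_top.mpr hi)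
    rw [Set.mem_iInter₂] at hη
    have hsub : {i | E y i ≠ ⊤} ⊆ {i | E x i ≠ ⊤} := fun i hi ↦
      mem_support_iff_stalkIdeal_ne_top.mp (hηx.mem_closed (D i).support.isClosed (hη i hi))
    have hEη : ∀ {y'} (h : η ⤳ y'), (fun i ↦ (E y' i).map (X.presheaf.stalkSpecializes h).hom) =
        E η := fun h ↦ funext fun i ↦ map_stalkIdeal_stalkSpecializes (D i) h
    refine hm (le_trans (fun f hf ↦ ?_) (boxIdeal_mono (E x) hsub m))
    have hfη : (X.presheaf.stalkSpecializes hηx).hom f ∈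
        (boxIdeal (E x) {i | E y i ≠ ⊤} m).map (X.presheaf.stalkSpecializes hηx).hom := by
      have h1 := Ideal.map_mono (f := (X.presheaf.stalkSpecializes hηy).hom) hle
      rw [map_boxIdeal, hEη, map_stalkIdeal_stalkSpecializes] at h1
      rw [map_boxIdeal, hEη]
      refine h1 ?_
      rw [← map_stalkIdeal_stalkSpecializes J hηx]
      exact Ideal.mem_map_of_mem _ hf
    obtain ⟨a, ha, haf⟩ := exists_mul_mem_of_stalkSpecializes_mem hηx _ f hfη
    -- The denominator `a`, a unit at `η`, avoids the prime at `x` of the components through `y`, so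
    -- primariness cancels it.
    refine mem_boxIdeal_of_mul_mem (E := E x) hw hz hsub m (fun hmem ↦ ?_) haf
    have h2 := Ideal.mem_map_of_mem (X.presheaf.stalkSpecializes hηx).hom hmem
    have h3 : (⨆ i ∈ {i | E y i ≠ ⊤}, E x i).map (X.presheaf.stalkSpecializes hηx).hom ≤
        IsLocalRing.maximalIdeal (X.presheaf.stalk η) := by
      simp only [Ideal.map_iSup]
      refine iSup₂_le fun i hi ↦ IsLocalRing.le_maximalIdeal ?_
      rw [map_stalkIdeal_stalkSpecializes]
      exact mem_support_iff_stalkIdeal_ne_top.mp (hη i hi)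
    exact (IsLocalRing.mem_maximalIdeal _).mp (h3 h2) ha
  · rw [stalkIdeal_iSup_monomialIdeal]
    refine monomialHull_le ?_
    rw [← stalkIdeal_iSup_monomialIdeal]
    exact hU₁ y hy.1

end Hull

end ToroidalHull

theorem mainTheorem5 {k : Type u} [Field k] {X : Scheme.{u}} (π : X ⟶ Spec (CommRingCat.of k))
    [IsIntegral X] [Smooth π] [IsSeparated π] [QuasiCompact π]
    {ι : Type v} [Fintype ι] (D : ι → X.IdealSheafData) (hD : ToroidalHull.IsSNC D)
    (J : X.IdealSheafData) :
    (∃! Jt : X.IdealSheafData, ToroidalHull.IsToroidalHull D J Jt) ∧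
    ∀ Jt : X.IdealSheafData, ToroidalHull.IsToroidalHull D J Jt →
      ∀ (W : Set X) (hW : ToroidalHull.IsStratum D W),
        ToroidalHull.multAlong Jt hW.isIrreducible =
          ToroidalHull.multAlong J hW.isIrreducible := by
  open ToroidalHull in
  have : IsLocallyNoetherian X := LocallyOfFiniteType.isLocallyNoetherian π
  have : CompactSpace X := QuasiCompact.compactSpace_of_compactSpace π
  have : IsNoetherian X := {}
  obtain ⟨K, hK⟩ := exists_stalkIdeal_eq
    (fun x ↦ monomialHull (fun i ↦ stalkIdeal (D i) x) (stalkIdeal J x)) fun x ↦ by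
      obtain ⟨U, hx, S, hS⟩ := exists_stalkIdeal_eq_monomialHull hD J x
      exact ⟨U, hx, _, hS⟩
  have hJK : J ≤ K := le_of_stalkIdeal_le fun x ↦ by
    obtain ⟨w, hw, hz⟩ := hD.exists_generators x
    rw [hK]
    exact le_monomialHull hw hz _
  have hleast : IsToroidalHull D J K := by
    refine ⟨⟨fun x ↦ ?_, hJK⟩, fun I ⟨hI, hJI⟩ ↦ le_of_stalkIdeal_le fun x ↦ ?_⟩
    · obtain ⟨U, hx, S, hS⟩ := exists_stalkIdeal_eq_monomialHull hD J x
      exact ⟨U, hx, S, eqOn_iff.mpr fun y hy ↦ (hK y).trans (hS y hy).symm⟩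
    · obtain ⟨U, hx, S, hS⟩ := hI x
      have := eqOn_iff.mp hS x hx
      rw [stalkIdeal_iSup_monomialIdeal] at this
      rw [hK, this]
      refine monomialHull_le ?_
      rw [← this]
      exact stalkIdeal_mono hJI x
  refine ⟨⟨K, hleast, fun K' h ↦ IsLeast.unique h hleast⟩, fun Jt hJt W hW ↦ ?_⟩
  obtain rfl : Jt = K := IsLeast.unique hJt hleast
  refine iSup_congr fun n ↦ iSup_congr_Prop ⟨(stalkIdeal_mono hJK _).trans, fun h ↦ ?_⟩ fun _ ↦ rfl
  rw [hK]
  exact monomialHull_le_pow (hW.maximalIdeal_eq hD) h
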